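/- Let $n \ge 4$ be an integer and let $q$ be a prime power. Let $K_q(n,2)$ be the $q$-Kneser graph: its vertices are the $2$-dimensional subspaces of $\mathbb{F}_q^n$, and two vertices are adjacent if and only if they intersect trivially. For a finite graph $G$ let $\tau(G)$ be the maximum number of vertices of an induced forest in $G$. A set $F$ of vertices inducing a forest is called canonical if there is a vertex $v \in F$ such that $F \setminus \{v\}$ is an independent set, and it is called maximum if $|F| = \tau(G)$. Write $\binom{m}{k}_q$ for the Gaussian binomial coefficient, so $\binom{n-1}{1}_q = (q^{n-1}-1)/(q-1)$. Then $$\tau(K_q(n,2)) = \max\left\{ \binom{n-1}{1}_q + 1,\; 8 \right\},$$ and if $(n,q) \ne (4,2)$, then every maximum induced forest in $K_q(n,2)$ is canonical. -/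

import Mathlib

/-- The Gaussian (`q`-)binomial coefficient, by the `q`-Pascal recursion
`[n+1, k+1] = [n, k] + q ^ (k+1) * [n, k+1]`. -/
def gaussianBinomial (q : ℕ) : ℕ → ℕ → ℕ
  | _, 0 => 1
  | 0, _ + 1 => 0
  | n + 1, k + 1 => gaussianBinomial q n k + q ^ (k + 1) * gaussianBinomial q n (k + 1)

/-- The vertices of the `q`-Kneser graph: the `k`-dimensional subspaces of `K ^ n`. -/
abbrev QKneserVertex (K : Type*) [Field K] (n k : ℕ) : Type _ :=
  {U : Submodule K (Fin n → K) // Module.finrank K U = k}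

/-- The `q`-Kneser graph over the field `K`: two distinct `k`-dimensional subspaces of `K ^ n`
are adjacent iff they intersect trivially. (Distinctness is automatic for `1 ≤ k`.) -/
def qKneserGraph (K : Type*) [Field K] (n k : ℕ) : SimpleGraph (QKneserVertex K n k) where
  Adj U W := U ≠ W ∧ U.1 ⊓ W.1 = ⊥
  symm := ⟨fun _ _ h => ⟨h.1.symm, by rw [inf_comm]; exact h.2⟩⟩
  loopless := ⟨fun _ h => h.1 rfl⟩

/-- A finite set of vertices that induces a forest. -/
def IsInducedForest {V : Type*} (G : SimpleGraph V) (F : Finset V) : Prop :=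
  (G.induce (F : Set V)).IsAcyclic

/-- The acyclic number of a finite graph: the maximum number of vertices inducing a forest. -/
noncomputable def acyclicNumber {V : Type*} [Finite V] (G : SimpleGraph V) : ℕ :=
  sSup {m : ℕ | ∃ F : Finset V, IsInducedForest G F ∧ F.card = m}

/-- An induced forest of maximum possible order. -/
def IsMaximumInducedForest {V : Type*} (G : SimpleGraph V) (F : Finset V) : Prop :=
  IsInducedForest G F ∧ ∀ F' : Finset V, IsInducedForest G F' → F'.card ≤ F.card

/-- An induced forest is canonical if deleting some one of its vertices leaves an
independent set. -/
def IsCanonicalForest {V : Type*} (G : SimpleGraph V) (F : Finset V) : Prop :=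
  IsInducedForest G F ∧ ∃ v ∈ F, G.IsIndepSet ((F : Set V) \ {v})

/-! ### Forests in arbitrary graphs. -/

section GraphLemmas

variable {V : Type*} {G : SimpleGraph V}

/-! Read projectively: vertices are lines, and independent sets are families of pairwise meeting
lines. Write θ for the number of lines through a point. All lines through a point plus one further
line form a star together with isolated vertices, giving θ + 1. For the upper bound, a forest F is
2-colourable, so half of it meets pairwise and lies in a family I of all lines through a point or
all lines in a plane (`exists_point_or_plane`). Put A = F ∩ I and B = F \ I, so |B| ≤ |A| ≤ θ. A
line outside I meets at most q + 1 members of I, hence is adjacent to the rest of A, while a forest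
has fewer than |A| + |B| edges between A and B. Thus |B|(|A| - q - 1) < |A| + |B|
(`IsMeetingFamily.card_mul_lt`). If |F| > θ, this forces |B| = 1 unless (n, q) = (4, 2), so F is
canonical of size θ + 1. For (4, 2) the count alone does not exclude nine vertices;
`IsInducedForest.card_le_eight` uses finer incidence geometry. Since θ ≥ 7 always, the 8 in the
maximum is never the larger term. -/

theorem IsInducedForest.mono {F F' : Finset V} (h : IsInducedForest G F) (hs : F' ⊆ F) :
    IsInducedForest G F' :=
  SimpleGraph.IsAcyclic.embedding (SimpleGraph.induceHomOfLE G (by exact_mod_cast hs)) h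

theorem SimpleGraph.IsAcyclic.card_edgeFinset_lt [Fintype V] [Nonempty V] [Fintype G.edgeSet]
    (h : G.IsAcyclic) : G.edgeFinset.card + 1 ≤ Fintype.card V := by
  classical
  -- Extend to a spanning tree, whose edge number is known.
  obtain ⟨H, hGH, hH⟩ := SimpleGraph.exists_maximal_isAcyclic_of_le_isAcyclic (le_top (a := G)) h
  have hT : H.IsTree := SimpleGraph.maximal_isAcyclic_iff_isTree.1 (by simpa using hH)
  rw [← hT.card_edgeFinset]
  exact Nat.add_le_add_right (Finset.card_le_card (SimpleGraph.edgeFinset_mono hGH)) 1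

open Classical in
/-- A forest on `A ∪ B` has fewer edges between `A` and `B` than vertices. -/
theorem IsInducedForest.sum_card_adj_lt {F A B : Finset V} (h : IsInducedForest G F)
    (hA : A ⊆ F) (hB : B ⊆ F) (hd : Disjoint A B) (hne : B.Nonempty) :
    (∑ b ∈ B, (A.filter (G.Adj b)).card) + 1 ≤ A.card + B.card := by
  have h' := h.mono (Finset.union_subset hA hB)
  rw [← Finset.card_union_of_disjoint hd]
  have : Nonempty ((A ∪ B : Finset V) : Set V) := by
    obtain ⟨b, hb⟩ := hne
    exact ⟨⟨b, by simp [hb]⟩⟩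
  have h2 := SimpleGraph.IsAcyclic.card_edgeFinset_lt h'
  have h3 : Fintype.card ((A ∪ B : Finset V) : Set V) = (A ∪ B).card := by simp
  rw [h3] at h2
  refine le_trans (Nat.add_le_add_right ?_ 1) h2
  rw [← Finset.card_sigma]
  have hmem : ∀ x ∈ B.sigma (fun b => A.filter (G.Adj b)), x.1 ∈ B ∧ x.2 ∈ A ∧ G.Adj x.1 x.2 := by
    intro x hx
    simpa using hx
  refine Finset.card_le_card_of_injOn
    (fun x => if hx : x ∈ B.sigma (fun b => A.filter (G.Adj b)) then
      s(⟨x.1, by simp [(hmem x hx).1]⟩, ⟨x.2, by simp [(hmem x hx).2.1]⟩) else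
      -- Junk value, never taken on the domain of the injection.
      s(Classical.arbitrary _, Classical.arbitrary _)) ?_ ?_
  · intro x hx
    have hx' := Finset.mem_coe.1 hx
    have := hmem x hx'
    simp [hx', this.2.2]
  · rintro ⟨b, a⟩ hx ⟨b', a'⟩ hy hxy
    have hx' := Finset.mem_coe.1 hx
    have hy' := Finset.mem_coe.1 hy
    have h1 := hmem _ hx'
    have h2 := hmem _ hy'
    simp only [hx', hy', dif_pos, Sym2.eq_iff, Subtype.mk.injEq] at hxy
    rcases hxy with ⟨rfl, rfl⟩ | ⟨hba, -⟩
    · rfl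
    · exact absurd h2.2.1 (hba ▸ Finset.disjoint_right.1 hd h1.1)

open Classical in
/-- Two vertices of a forest have at most one common neighbour in it. -/
theorem IsInducedForest.card_common_le_one {F A : Finset V} (h : IsInducedForest G F)
    (hA : A ⊆ F) {b b' : V} (hb : b ∈ F) (hb' : b' ∈ F) (hbA : b ∉ A) (hbA' : b' ∉ A)
    (hne : b ≠ b') : (A.filter fun a => G.Adj b a ∧ G.Adj b' a).card ≤ 1 := by
  set C := A.filter fun a => G.Adj b a ∧ G.Adj b' a with hC
  have hCA : C ⊆ A := Finset.filter_subset _ _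
  have := h.sum_card_adj_lt (A := C) (B := {b, b'}) (hCA.trans hA)
    (by intro x; simp only [Finset.mem_insert, Finset.mem_singleton]; rintro (rfl | rfl) <;> assumption)
    (by
      rw [Finset.disjoint_right]
      intro x; simp only [Finset.mem_insert, Finset.mem_singleton]
      rintro (rfl | rfl) hx
      · exact hbA (hCA hx)
      · exact hbA' (hCA hx)) (by simp)
  -- Both vertices are adjacent to all of `C`, so the edge count reads 2|C| + 1 ≤ |C| + 2.
  rw [Finset.sum_pair hne, Finset.card_pair hne,
    Finset.filter_true_of_mem (fun x hx => (Finset.mem_filter.1 hx).2.1),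
    Finset.filter_true_of_mem (fun x hx => (Finset.mem_filter.1 hx).2.2)] at this
  omega

/-- A forest contains an independent set with at least half of its vertices. -/
theorem IsInducedForest.exists_indep {F : Finset V} (h : IsInducedForest G F) :
    ∃ A ⊆ F, G.IsIndepSet (A : Set V) ∧ F.card ≤ 2 * A.card := by
  classical
  obtain ⟨c⟩ := SimpleGraph.IsAcyclic.colorable_two h
  have key : ∀ i : Fin 2, G.IsIndepSet
      ((F.filter fun v => ∃ hv : v ∈ F, c ⟨v, hv⟩ = i : Finset V) : Set V) := by
    intro i v hv w hw _ hvw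
    obtain ⟨-, hvF, hv⟩ := Finset.mem_filter.1 (Finset.mem_coe.1 hv)
    obtain ⟨-, hwF, hw⟩ := Finset.mem_filter.1 (Finset.mem_coe.1 hw)
    exact c.valid (v := ⟨v, hvF⟩) (w := ⟨w, hwF⟩) hvw (hv.trans hw.symm)
  have hcov : F ⊆ (F.filter fun v => ∃ hv : v ∈ F, c ⟨v, hv⟩ = 0) ∪
      (F.filter fun v => ∃ hv : v ∈ F, c ⟨v, hv⟩ = 1) := by
    intro v hv
    have : c ⟨v, hv⟩ = 0 ∨ c ⟨v, hv⟩ = 1 := by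
      generalize c ⟨v, hv⟩ = i
      fin_cases i <;> simp
    rcases this with h0 | h1
    · exact Finset.mem_union_left _ (Finset.mem_filter.2 ⟨hv, hv, h0⟩)
    · exact Finset.mem_union_right _ (Finset.mem_filter.2 ⟨hv, hv, h1⟩)
  have hcard := (Finset.card_le_card hcov).trans (Finset.card_union_le _ _)
  rcases le_total (F.filter fun v => ∃ hv : v ∈ F, c ⟨v, hv⟩ = 0).card
    (F.filter fun v => ∃ hv : v ∈ F, c ⟨v, hv⟩ = 1).card with h1 | h1
  · exact ⟨_, Finset.filter_subset _ _, key 1, by omega⟩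
  · exact ⟨_, Finset.filter_subset _ _, key 0, by omega⟩

/-- Every edge passes through `v`, so the induced graph is a subgraph of a star. -/
theorem isInducedForest_insert [DecidableEq V] {I : Finset V} (hI : G.IsIndepSet (I : Set V))
    (v : V) : IsInducedForest G (insert v I) := by
  have hv : v ∈ ((insert v I : Finset V) : Set V) := by simp
  refine SimpleGraph.IsAcyclic.anti (G' := SimpleGraph.starGraph ⟨v, hv⟩) ?_
    (SimpleGraph.isTree_starGraph _).isAcyclic
  rintro ⟨x, hx⟩ ⟨y, hy⟩ hxy
  have hxy' : G.Adj x y := hxy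
  simp only [Finset.coe_insert, Set.mem_insert_iff, Finset.mem_coe] at hx hy
  rw [SimpleGraph.starGraph_adj]
  refine ⟨fun h => hxy.ne h, ?_⟩
  by_contra! hcon
  have h1 : x ≠ v := fun h => hcon.1 (Subtype.ext h)
  have h2 : y ≠ v := fun h => hcon.2 (Subtype.ext h)
  exact hI (by simpa [h1] using hx) (by simpa [h2] using hy) hxy'.ne hxy'

end GraphLemmas

/-! ### Counting lines through a point and lines in a plane. -/

section Counting

variable {K : Type*} [Field K] {n : ℕ}

theorem gaussianBinomial_succ_one (q m : ℕ) :
    gaussianBinomial q (m + 1) 1 = 1 + q * gaussianBinomial q m 1 := by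
  simp [gaussianBinomial]

theorem gaussianBinomial_one_mul_add_one {q : ℕ} (hq : 1 ≤ q) (m : ℕ) :
    gaussianBinomial q m 1 * (q - 1) + 1 = q ^ m := by
  obtain ⟨r, rfl⟩ := Nat.exists_eq_add_of_le' hq
  induction m with
  | zero => simp [gaussianBinomial]
  | succ m ih =>
    rw [gaussianBinomial_succ_one, pow_succ, ← ih]
    simp only [Nat.add_sub_cancel]
    ring

theorem gaussianBinomial_one_mono {q : ℕ} (hq : 1 ≤ q) :
    Monotone fun m => gaussianBinomial q m 1 := by
  refine monotone_nat_of_le_succ fun m => ?_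
  rw [gaussianBinomial_succ_one]
  nlinarith [Nat.zero_le (gaussianBinomial q m 1)]

theorem finrank_sup_span_singleton {P : Submodule K (Fin n → K)} {v : Fin n → K} (hv : v ∉ P) :
    Module.finrank K ↥(P ⊔ K ∙ v) = Module.finrank K P + 1 := by
  have hv0 : v ≠ 0 := fun h => hv (h ▸ P.zero_mem)
  have h1 := Submodule.finrank_sup_add_finrank_inf_eq P (K ∙ v)
  have h2 : P ⊓ (K ∙ v) = ⊥ := by
    rw [← disjoint_iff, Submodule.disjoint_span_singleton' hv0]
    exact hv
  rw [h2, finrank_bot, finrank_span_singleton hv0] at h1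
  simpa using h1

open Classical in
theorem card_mem_notMem {U W : Submodule K (Fin n → K)} (h : U ≤ W) [Fintype (Fin n → K)] :
    (Finset.univ.filter fun v => v ∈ W ∧ v ∉ U).card + Nat.card K ^ Module.finrank K U =
      Nat.card K ^ Module.finrank K W := by
  have hc : ∀ U : Submodule K (Fin n → K),
      (Finset.univ.filter fun v => v ∈ U).card = Nat.card K ^ Module.finrank K U := by
    intro U
    rw [← Module.natCard_eq_pow_finrank (K := K) (V := U), ← Fintype.card_subtype,
      ← Nat.card_eq_fintype_card]
  rw [← hc, ← hc, ← Finset.card_union_of_disjoint]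
  · congr 1
    ext v
    simp only [Finset.mem_union, Finset.mem_filter, Finset.mem_univ, true_and]
    have := @h v
    tauto
  · rw [Finset.disjoint_left]
    intro v hv hv'
    simp only [Finset.mem_filter, Finset.mem_univ, true_and] at hv hv'
    exact hv.2 hv'

variable [Finite K]

/-- The number of lines through a point `P` in a subspace `Q`. -/
theorem ncard_lines_between {P Q : Submodule K (Fin n → K)} (hP : Module.finrank K P = 1)
    (hPQ : P ≤ Q) :
    {c : QKneserVertex K n 2 | P ≤ c.1 ∧ c.1 ≤ Q}.ncard * (Nat.card K ^ 2 - Nat.card K) +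
      Nat.card K = Nat.card K ^ Module.finrank K Q := by
  classical
  have : Fintype (Fin n → K) := Fintype.ofFinite _
  have : Fintype (QKneserVertex K n 2) := Fintype.ofFinite _
  have h1 := card_mem_notMem hPQ
  rw [hP, pow_one] at h1
  rw [← h1]
  congr 1
  rw [Set.ncard_eq_toFinset_card']
  set S := {c : QKneserVertex K n 2 | P ≤ c.1 ∧ c.1 ≤ Q}.toFinset with hS
  have hSm : ∀ c, c ∈ S ↔ P ≤ c.1 ∧ c.1 ≤ Q := by intro c; simp [hS]
  -- The lines through `P` partition the vectors of `Q` outside `P` into classes of size q² - q.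
  have hU : (Finset.univ.filter fun v => v ∈ Q ∧ v ∉ P) =
      S.biUnion fun c => Finset.univ.filter fun v => v ∈ c.1 ∧ v ∉ P := by
    ext v
    simp only [Finset.mem_filter, Finset.mem_univ, true_and, Finset.mem_biUnion, hSm]
    constructor
    · rintro ⟨hvQ, hvP⟩
      refine ⟨⟨P ⊔ K ∙ v, by rw [finrank_sup_span_singleton hvP, hP]⟩, ⟨le_sup_left, ?_⟩, ?_, hvP⟩
      · exact sup_le hPQ (by simpa using hvQ)
      · exact Submodule.mem_sup_right (Submodule.mem_span_singleton_self v)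
    · rintro ⟨c, ⟨-, hc⟩, hv, hvP⟩
      exact ⟨hc hv, hvP⟩
  rw [hU, Finset.card_biUnion]
  · rw [← smul_eq_mul, ← Finset.sum_const]
    refine Finset.sum_congr rfl fun c hc => ?_
    have := card_mem_notMem ((hSm c).1 hc).1
    rw [hP, c.2, pow_one] at this
    omega
  · intro c hc d hd hcd
    rw [Function.onFun, Finset.disjoint_left]
    intro v hv hv'
    simp only [Finset.mem_filter, Finset.mem_univ, true_and] at hv hv'
    refine hcd ?_
    have key : ∀ c ∈ S, v ∈ c.1 → P ⊔ K ∙ v = c.1 := by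
      intro c hc hvc
      refine Submodule.eq_of_le_of_finrank_eq (sup_le ((hSm c).1 hc).1 (by simpa using hvc)) ?_
      rw [finrank_sup_span_singleton hv.2, hP, c.2]
    exact Subtype.ext ((key c hc hv.1).symm.trans (key d hd hv'.1))

theorem ncard_lines_between_of_finrank_three {P Q : Submodule K (Fin n → K)}
    (hP : Module.finrank K P = 1) (hQ : Module.finrank K Q = 3) (hPQ : P ≤ Q) :
    {c : QKneserVertex K n 2 | P ≤ c.1 ∧ c.1 ≤ Q}.ncard = Nat.card K + 1 := by
  have h := ncard_lines_between hP hPQ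
  rw [hQ] at h
  obtain ⟨r, hr⟩ := Nat.exists_eq_add_of_le' (Finite.one_lt_card (α := K))
  rw [hr] at h ⊢
  have h1 : (r + 2) ^ 2 - (r + 2) = (r + 2) * (r + 1) := by
    rw [Nat.sub_eq_iff_eq_add (by nlinarith)]; ring
  rw [h1] at h
  have : 0 < (r + 2) * (r + 1) := by positivity
  apply Nat.eq_of_mul_eq_mul_right this
  linarith [show (r + 2) ^ 3 = (r + 1 + 1 + 1) * ((r + 2) * (r + 1)) + (r + 2) by ring]

theorem ncard_lines_through {P : Submodule K (Fin n → K)} (hP : Module.finrank K P = 1)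
    (hn : 1 ≤ n) :
    {c : QKneserVertex K n 2 | P ≤ c.1}.ncard = gaussianBinomial (Nat.card K) (n - 1) 1 := by
  have h := ncard_lines_between hP (le_top : P ≤ ⊤)
  simp only [le_top, and_true, finrank_top, Module.finrank_fin_fun] at h
  have hq := Finite.one_lt_card (α := K)
  have h2 := gaussianBinomial_one_mul_add_one hq.le (n - 1)
  obtain ⟨m, rfl⟩ := Nat.exists_eq_add_of_le' hn
  simp only [Nat.add_sub_cancel] at h2 ⊢
  obtain ⟨r, hr⟩ := Nat.exists_eq_add_of_le' hq
  rw [hr] at h h2 ⊢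
  have h1 : (r + 2) ^ 2 - (r + 2) = (r + 2) * (r + 1) := by
    rw [Nat.sub_eq_iff_eq_add (by nlinarith)]; ring
  have h3 : r + 2 - 1 = r + 1 := rfl
  rw [h1, pow_succ, ← h2, h3] at h
  have : 0 < (r + 2) * (r + 1) := by positivity
  apply Nat.eq_of_mul_eq_mul_right this
  linarith

theorem ncard_lines_in_plane {Q : Submodule K (Fin n → K)} (hQ : Module.finrank K Q = 3) :
    {c : QKneserVertex K n 2 | c.1 ≤ Q}.ncard = gaussianBinomial (Nat.card K) 3 1 := by
  classical
  have : Fintype (Fin n → K) := Fintype.ofFinite _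
  have : Fintype (QKneserVertex K n 2) := Fintype.ofFinite _
  rw [Set.ncard_eq_toFinset_card']
  set T := {c : QKneserVertex K n 2 | c.1 ≤ Q}.toFinset with hT
  have hTm : ∀ c, c ∈ T ↔ c.1 ≤ Q := by intro c; simp [hT]
  -- Double count incidences between lines of `Q` and nonzero vectors of `Q`.
  have hdc := Finset.sum_card_bipartiteAbove_eq_sum_card_bipartiteBelow
    (fun (c : QKneserVertex K n 2) (v : Fin n → K) => v ∈ c.1) (s := T)
    (t := Finset.univ.filter fun v => v ∈ Q ∧ v ∉ (⊥ : Submodule K (Fin n → K)))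
  have hl : ∀ c ∈ T, (Finset.bipartiteAbove (fun (c : QKneserVertex K n 2) (v : Fin n → K) =>
      v ∈ c.1) (Finset.univ.filter fun v => v ∈ Q ∧ v ∉ (⊥ : Submodule K (Fin n → K))) c).card =
      Nat.card K ^ 2 - 1 := by
    intro c hc
    have := card_mem_notMem (bot_le (a := c.1))
    rw [finrank_bot, pow_zero, c.2] at this
    rw [← this, Nat.add_sub_cancel]
    congr 1
    ext v
    have hcQ : v ∈ c.1 → v ∈ Q := fun h => (hTm c).1 hc h
    simp only [Finset.bipartiteAbove, Finset.mem_filter, Finset.mem_univ, true_and]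
    tauto
  have hr : ∀ v ∈ (Finset.univ.filter fun v => v ∈ Q ∧ v ∉ (⊥ : Submodule K (Fin n → K))),
      (Finset.bipartiteBelow (fun (c : QKneserVertex K n 2) (v : Fin n → K) =>
      v ∈ c.1) T v).card = Nat.card K + 1 := by
    intro v hv
    simp only [Finset.mem_filter, Finset.mem_univ, true_and, Submodule.mem_bot] at hv
    rw [← ncard_lines_between_of_finrank_three (P := K ∙ v) (finrank_span_singleton hv.2) hQ
      (by simpa using hv.1), Set.ncard_eq_toFinset_card']
    congr 1
    ext c
    simp [Finset.bipartiteBelow, hTm, and_comm]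
  rw [Finset.sum_congr rfl hl, Finset.sum_congr rfl hr, Finset.sum_const, Finset.sum_const,
    smul_eq_mul, smul_eq_mul] at hdc
  have h1 := card_mem_notMem (bot_le (a := Q))
  rw [finrank_bot, pow_zero, hQ] at h1
  have hq := Finite.one_lt_card (α := K)
  have h4 : gaussianBinomial (Nat.card K) 3 1 = 1 + Nat.card K * (1 + Nat.card K) := by
    simp [gaussianBinomial]
  rw [h4]
  obtain ⟨r, hr⟩ : ∃ r, Nat.card K = r + 2 := Nat.exists_eq_add_of_le' hq
  rw [hr] at hdc h1 ⊢
  have h2 : (r + 2) ^ 2 - 1 = (r + 1) * (r + 3) := by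
    rw [Nat.sub_eq_iff_eq_add (by nlinarith)]; ring
  have h3 : (Finset.univ.filter fun v => v ∈ Q ∧ v ∉ (⊥ : Submodule K (Fin n → K))).card =
      (r + 2) ^ 3 - 1 := by omega
  have h5 : (r + 2) ^ 3 - 1 = (r + 1) * ((r + 2) ^ 2 + (r + 2) + 1) := by
    rw [Nat.sub_eq_iff_eq_add (by exact Nat.one_le_pow _ _ (by omega))]; ring
  rw [h2, h3, h5] at hdc
  have : 0 < (r + 1) * (r + 3) := by positivity
  apply Nat.eq_of_mul_eq_mul_right this
  linarith

end Counting

/-! ### Maximal families of pairwise meeting lines. -/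

section Pencils

variable {K : Type*} [Field K] {n : ℕ}

theorem qKneserGraph_adj_iff {b c : QKneserVertex K n 2} :
    (qKneserGraph K n 2).Adj b c ↔ b.1 ⊓ c.1 = ⊥ := by
  refine ⟨fun h => h.2, fun h => ⟨?_, h⟩⟩
  rintro rfl
  have := b.2
  rw [inf_idem] at h
  rw [h, finrank_bot] at this
  omega

theorem one_le_finrank_of_ne_bot {U : Submodule K (Fin n → K)} (h : U ≠ ⊥) :
    1 ≤ Module.finrank K U :=
  Submodule.one_le_finrank_iff.2 h

theorem QKneserVertex.finrank_inf_le_one {a : QKneserVertex K n 2}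
    {Q : Submodule K (Fin n → K)} (h : ¬ a.1 ≤ Q) : Module.finrank K ↥(a.1 ⊓ Q) ≤ 1 := by
  have h1 : a.1 ⊓ Q < a.1 := lt_of_le_of_ne inf_le_left fun h' => h (inf_eq_left.1 h')
  have := Submodule.finrank_lt_finrank_of_lt h1
  rw [a.2] at this
  omega

theorem QKneserVertex.not_le_of_ne {a b : QKneserVertex K n 2} (h : a ≠ b) : ¬ a.1 ≤ b.1 :=
  fun hle => h (Subtype.ext (Submodule.eq_of_le_of_finrank_eq hle (a.2.trans b.2.symm)))

theorem inf_eq_bot_of_finrank_eq_one {P U : Submodule K (Fin n → K)}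
    (hP : Module.finrank K P = 1) (h : ¬ P ≤ U) : P ⊓ U = ⊥ := by
  by_contra hne
  have h1 := one_le_finrank_of_ne_bot hne
  exact h (inf_eq_left.1 (Submodule.eq_of_le_of_finrank_le inf_le_left (by omega)))

theorem finrank_point_sup_line {P : Submodule K (Fin n → K)} (hP : Module.finrank K P = 1)
    {b : QKneserVertex K n 2} (h : ¬ P ≤ b.1) : Module.finrank K ↥(P ⊔ b.1) = 3 := by
  have := Submodule.finrank_sup_add_finrank_inf_eq P b.1
  rw [inf_eq_bot_of_finrank_eq_one hP h, finrank_bot, hP, b.2] at this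
  simpa using this

theorem exists_line_between {P Q : Submodule K (Fin n → K)} (hP : Module.finrank K P = 1)
    (hPQ : P ≤ Q) (hQ : 2 ≤ Module.finrank K Q) :
    ∃ c : QKneserVertex K n 2, P ≤ c.1 ∧ c.1 ≤ Q := by
  have : ¬ Q ≤ P := fun h => by
    have := Submodule.finrank_mono h
    omega
  obtain ⟨v, hvQ, hvP⟩ := SetLike.not_le_iff_exists.1 this
  exact ⟨⟨P ⊔ K ∙ v, by rw [finrank_sup_span_singleton hvP, hP]⟩, le_sup_left,
    sup_le hPQ (by simpa using hvQ)⟩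

/-- The members of the point family met by `b` are thus the pencil at `P` in the plane `P ⊔ b`. -/
theorem inf_ne_bot_iff_le_sup {P : Submodule K (Fin n → K)} (hP : Module.finrank K P = 1)
    {b c : QKneserVertex K n 2} (hb : ¬ P ≤ b.1) (hc : P ≤ c.1) :
    b.1 ⊓ c.1 ≠ ⊥ ↔ c.1 ≤ P ⊔ b.1 := by
  constructor
  · intro h
    have h1 := one_le_finrank_of_ne_bot h
    have h2 := Submodule.finrank_sup_add_finrank_inf_eq P (b.1 ⊓ c.1)
    rw [inf_eq_bot_of_finrank_eq_one hP (fun h => hb (h.trans inf_le_left)), finrank_bot, hP] at h2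
    have h3 : P ⊔ b.1 ⊓ c.1 = c.1 := by
      refine Submodule.eq_of_le_of_finrank_le (sup_le hc inf_le_right) ?_
      rw [c.2]
      omega
    rw [← h3]
    exact sup_le_sup_left inf_le_left _
  · intro h hbot
    have h1 := Submodule.finrank_sup_add_finrank_inf_eq b.1 c.1
    have h2 := Submodule.finrank_mono (sup_le le_sup_right h : b.1 ⊔ c.1 ≤ P ⊔ b.1)
    rw [finrank_point_sup_line hP hb] at h2
    rw [hbot, finrank_bot, b.2, c.2] at h1
    omega

/-- Dual to the point case: unless `b` misses `Q`, the lines of `Q` that it meets form the pencil at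
the point `b ⊓ Q`. -/
theorem inf_ne_bot_iff_inf_le {Q : Submodule K (Fin n → K)}
    {b c : QKneserVertex K n 2} (hb : ¬ b.1 ≤ Q) (hc : c.1 ≤ Q) :
    b.1 ⊓ c.1 ≠ ⊥ ↔ b.1 ⊓ Q ≠ ⊥ ∧ b.1 ⊓ Q ≤ c.1 := by
  have hle : b.1 ⊓ c.1 ≤ b.1 ⊓ Q := inf_le_inf_left _ hc
  have h2 := QKneserVertex.finrank_inf_le_one hb
  constructor
  · intro h
    have h1 := one_le_finrank_of_ne_bot h
    refine ⟨fun h' => h (le_bot_iff.1 (h' ▸ hle)), ?_⟩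
    rw [← Submodule.eq_of_le_of_finrank_le hle (by omega)]
    exact inf_le_right
  · rintro ⟨h, h'⟩ hbot
    exact h (le_bot_iff.1 (hbot ▸ le_inf inf_le_left h'))

/-- The properties shared by the two kinds of maximal families of pairwise meeting lines: all
lines through a point, and all lines in a plane. -/
structure IsMeetingFamily (I : Set (QKneserVertex K n 2)) : Prop where
  isIndepSet : (qKneserGraph K n 2).IsIndepSet I
  ncard_le : I.ncard ≤ gaussianBinomial (Nat.card K) (n - 1) 1
  ncard_meet_le : ∀ b ∉ I, {c ∈ I | b.1 ⊓ c.1 ≠ ⊥}.ncard ≤ Nat.card K + 1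
  meet_of_meet : ∀ b ∉ I, ∀ b' ∉ I, ∀ a₁ ∈ I, ∀ a₂ ∈ I, a₁ ≠ a₂ → b.1 ⊓ a₁.1 ≠ ⊥ →
    b.1 ⊓ a₂.1 ≠ ⊥ → b'.1 ⊓ a₁.1 ≠ ⊥ → b'.1 ⊓ a₂.1 ≠ ⊥ → ∀ c ∈ I, b.1 ⊓ c.1 ≠ ⊥ →
    b'.1 ⊓ c.1 ≠ ⊥
  exists_meet : n = 4 → ∀ b ∉ I, ∀ b' ∉ I, ∃ c ∈ I, b.1 ⊓ c.1 ≠ ⊥ ∧ b'.1 ⊓ c.1 ≠ ⊥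

theorem sup_eq_of_ne_of_le {a₁ a₂ : QKneserVertex K n 2} (hne : a₁ ≠ a₂)
    {D : Submodule K (Fin n → K)} (hD : Module.finrank K D = 3) (h₁ : a₁.1 ≤ D) (h₂ : a₂.1 ≤ D) :
    a₁.1 ⊔ a₂.1 = D := by
  have h1 := Submodule.finrank_sup_add_finrank_inf_eq a₁.1 a₂.1
  have h2 := QKneserVertex.finrank_inf_le_one (QKneserVertex.not_le_of_ne hne)
  refine Submodule.eq_of_le_of_finrank_le (sup_le h₁ h₂) ?_
  rw [a₁.2, a₂.2] at h1
  omega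

theorem eq_inf_of_ne_of_le {a₁ a₂ : QKneserVertex K n 2} (hne : a₁ ≠ a₂)
    {D : Submodule K (Fin n → K)} (hD : D ≠ ⊥) (h₁ : D ≤ a₁.1) (h₂ : D ≤ a₂.1) :
    D = a₁.1 ⊓ a₂.1 := by
  have h2 := QKneserVertex.finrank_inf_le_one (QKneserVertex.not_le_of_ne hne)
  have h3 := one_le_finrank_of_ne_bot hD
  exact Submodule.eq_of_le_of_finrank_le (le_inf h₁ h₂) (by omega)

/-- Lines meeting pairwise either share a point or lie in a common plane. -/
theorem exists_point_or_plane {A : Set (QKneserVertex K n 2)}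
    (hA : (qKneserGraph K n 2).IsIndepSet A) {a₁ a₂ : QKneserVertex K n 2} (h₁ : a₁ ∈ A)
    (h₂ : a₂ ∈ A) (hne : a₁ ≠ a₂) :
    (∃ P : Submodule K (Fin n → K), Module.finrank K P = 1 ∧ ∀ a ∈ A, P ≤ a.1) ∨
    (∃ Q : Submodule K (Fin n → K), Module.finrank K Q = 3 ∧ ∀ a ∈ A, a.1 ≤ Q) := by
  have hmeet : ∀ a ∈ A, ∀ b ∈ A, a.1 ⊓ b.1 ≠ ⊥ := by
    intro a ha b hb h
    have h' := qKneserGraph_adj_iff.2 h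
    exact hA ha hb h'.ne h'
  have hP : Module.finrank K ↥(a₁.1 ⊓ a₂.1) = 1 :=
    le_antisymm (QKneserVertex.finrank_inf_le_one (QKneserVertex.not_le_of_ne hne))
      (one_le_finrank_of_ne_bot (hmeet _ h₁ _ h₂))
  by_cases hall : ∀ a ∈ A, a₁.1 ⊓ a₂.1 ≤ a.1
  · exact Or.inl ⟨_, hP, hall⟩
  right
  push Not at hall
  obtain ⟨a₃, h₃, hPa₃⟩ := hall
  have hQ : Module.finrank K ↥(a₁.1 ⊔ a₂.1) = 3 := by
    have h1 := Submodule.finrank_sup_add_finrank_inf_eq a₁.1 a₂.1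
    rw [hP, a₁.2, a₂.2] at h1
    omega
  -- A line missing the point `a₁ ⊓ a₂` but meeting both lines lies in their plane. Lines through
  -- that point are then held in the plane because they meet `a₃`.
  have hplane : ∀ a ∈ A, ¬ a₁.1 ⊓ a₂.1 ≤ a.1 → a₁.1 ⊓ a₂.1 ⊔ a.1 = a₁.1 ⊔ a₂.1 := by
    intro a ha hPa
    exact (sup_eq_of_ne_of_le hne (finrank_point_sup_line hP hPa)
      ((inf_ne_bot_iff_le_sup hP hPa inf_le_left).1 (hmeet a ha a₁ h₁))
      ((inf_ne_bot_iff_le_sup hP hPa inf_le_right).1 (hmeet a ha a₂ h₂))).symm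
  refine ⟨a₁.1 ⊔ a₂.1, hQ, fun a ha => ?_⟩
  by_cases hPa : a₁.1 ⊓ a₂.1 ≤ a.1
  · rw [← hplane a₃ h₃ hPa₃]
    exact (inf_ne_bot_iff_le_sup hP hPa₃ hPa).1 (hmeet a₃ h₃ a ha)
  · rw [← hplane a ha hPa]
    exact le_sup_right

variable [Finite K]

theorem isMeetingFamily_linesThrough (hn : 4 ≤ n) {P : Submodule K (Fin n → K)}
    (hP : Module.finrank K P = 1) : IsMeetingFamily {c : QKneserVertex K n 2 | P ≤ c.1} where
  isIndepSet := by
    intro c hc d hd _ hcd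
    have h : P ≤ ⊥ := (qKneserGraph_adj_iff.1 hcd) ▸ le_inf hc hd
    rw [le_bot_iff.1 h, finrank_bot] at hP
    omega
  ncard_le := (ncard_lines_through hP (by omega)).le
  ncard_meet_le := by
    intro b hb
    rw [← ncard_lines_between_of_finrank_three hP (finrank_point_sup_line hP hb) le_sup_left]
    exact Set.ncard_le_ncard fun c hc => ⟨hc.1, (inf_ne_bot_iff_le_sup hP hb hc.1).1 hc.2⟩
  meet_of_meet := by
    intro b hb b' hb' a₁ ha₁ a₂ ha₂ hne h₁ h₂ h₁' h₂' c hc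
    rw [inf_ne_bot_iff_le_sup hP hb ‹_›] at *
    rw [inf_ne_bot_iff_le_sup hP hb' ‹_›] at *
    -- Two distinct lines of a pencil span its plane, so `b` and `b'` determine the same pencil.
    rw [← sup_eq_of_ne_of_le hne (finrank_point_sup_line hP hb) h₁ h₂,
      ← sup_eq_of_ne_of_le hne (finrank_point_sup_line hP hb') h₁' h₂']
    exact id
  exists_meet := by
    intro h4 b hb b' hb'
    have h1 := Submodule.finrank_sup_add_finrank_inf_eq (P ⊔ b.1) (P ⊔ b'.1)
    rw [finrank_point_sup_line hP hb, finrank_point_sup_line hP hb'] at h1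
    have h2 := Submodule.finrank_le ((P ⊔ b.1) ⊔ (P ⊔ b'.1))
    -- Two planes through `P` in a 4-dimensional space share a line through `P`.
    rw [Module.finrank_fin_fun] at h2
    obtain ⟨c, hPc, hc⟩ := exists_line_between (Q := (P ⊔ b.1) ⊓ (P ⊔ b'.1)) hP
      (le_inf le_sup_left le_sup_left) (by omega)
    exact ⟨c, hPc, (inf_ne_bot_iff_le_sup hP hb hPc).2 (hc.trans inf_le_left),
      (inf_ne_bot_iff_le_sup hP hb' hPc).2 (hc.trans inf_le_right)⟩

theorem isMeetingFamily_linesIn (hn : 4 ≤ n) {Q : Submodule K (Fin n → K)}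
    (hQ : Module.finrank K Q = 3) : IsMeetingFamily {c : QKneserVertex K n 2 | c.1 ≤ Q} where
  isIndepSet := by
    intro c hc d hd _ hcd
    have h1 := Submodule.finrank_sup_add_finrank_inf_eq c.1 d.1
    have h2 := Submodule.finrank_mono (show c.1 ⊔ d.1 ≤ Q from sup_le hc hd)
    rw [qKneserGraph_adj_iff.1 hcd, finrank_bot, c.2, d.2] at h1
    omega
  ncard_le := (ncard_lines_in_plane hQ).trans_le
    (gaussianBinomial_one_mono Nat.card_pos (by omega))
  ncard_meet_le := by
    intro b hb
    by_cases hbQ : b.1 ⊓ Q = ⊥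
    · have : {c ∈ {c : QKneserVertex K n 2 | c.1 ≤ Q} | b.1 ⊓ c.1 ≠ ⊥} = ∅ := by
        ext c
        simp only [Set.mem_ofPred_eq, Set.mem_empty_iff_false, iff_false, not_and]
        exact fun hc h => ((inf_ne_bot_iff_inf_le hb hc).1 h).1 hbQ
      rw [this, Set.ncard_empty]
      omega
    · have h1 : Module.finrank K ↥(b.1 ⊓ Q) = 1 :=
        le_antisymm (QKneserVertex.finrank_inf_le_one hb) (one_le_finrank_of_ne_bot hbQ)
      rw [← ncard_lines_between_of_finrank_three h1 hQ inf_le_right]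
      exact Set.ncard_le_ncard fun c hc => ⟨((inf_ne_bot_iff_inf_le hb hc.1).1 hc.2).2, hc.1⟩
  meet_of_meet := by
    intro b hb b' hb' a₁ ha₁ a₂ ha₂ hne h₁ h₂ h₁' h₂' c hc
    rw [inf_ne_bot_iff_inf_le hb ‹_›] at *
    rw [inf_ne_bot_iff_inf_le hb' ‹_›] at *
    -- Dually, two distinct lines of a pencil determine its point.
    rw [eq_inf_of_ne_of_le hne h₁.1 h₁.2 h₂.2, eq_inf_of_ne_of_le hne h₁'.1 h₁'.2 h₂'.2]
    exact id
  exists_meet := by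
    intro h4 b hb b' hb'
    have key : ∀ b : QKneserVertex K n 2, ¬ b.1 ≤ Q → Module.finrank K ↥(b.1 ⊓ Q) = 1 := by
      intro b hb
      have h1 := Submodule.finrank_sup_add_finrank_inf_eq b.1 Q
      have h2 := Submodule.finrank_le (b.1 ⊔ Q)
      have h3 := QKneserVertex.finrank_inf_le_one hb
      rw [Module.finrank_fin_fun] at h2
      rw [b.2, hQ] at h1
      omega
    have hne : ∀ b : QKneserVertex K n 2, ¬ b.1 ≤ Q → b.1 ⊓ Q ≠ ⊥ := by
      intro b hb h
      have := key b hb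
      rw [h, finrank_bot] at this
      omega
    -- In dimension 4 both lines meet `Q` in a point; a line of `Q` through both points works.
    suffices h : ∃ c : QKneserVertex K n 2, (b.1 ⊓ Q) ⊔ (b'.1 ⊓ Q) ≤ c.1 ∧ c.1 ≤ Q by
      obtain ⟨c, hc, hcQ⟩ := h
      exact ⟨c, hcQ, (inf_ne_bot_iff_inf_le hb hcQ).2 ⟨hne b hb, le_sup_left.trans hc⟩,
        (inf_ne_bot_iff_inf_le hb' hcQ).2 ⟨hne b' hb', le_sup_right.trans hc⟩⟩
    by_cases hle : b.1 ⊓ Q ≤ b'.1 ⊓ Q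
    · rw [sup_eq_right.2 hle]
      exact exists_line_between (key b' hb') inf_le_right (by omega)
    · have h1 := Submodule.finrank_sup_add_finrank_inf_eq (b.1 ⊓ Q) (b'.1 ⊓ Q)
      rw [inf_eq_bot_of_finrank_eq_one (key b hb) hle, finrank_bot, key b hb, key b' hb'] at h1
      exact ⟨⟨(b.1 ⊓ Q) ⊔ (b'.1 ⊓ Q), by omega⟩, le_rfl, sup_le inf_le_right inf_le_right⟩

theorem exists_isMeetingFamily (hn : 4 ≤ n) {A : Set (QKneserVertex K n 2)}
    (hA : (qKneserGraph K n 2).IsIndepSet A) {a₁ a₂ : QKneserVertex K n 2} (h₁ : a₁ ∈ A)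
    (h₂ : a₂ ∈ A) (hne : a₁ ≠ a₂) : ∃ I, IsMeetingFamily I ∧ A ⊆ I := by
  rcases exists_point_or_plane hA h₁ h₂ hne with ⟨P, hP, h⟩ | ⟨Q, hQ, h⟩
  · exact ⟨_, isMeetingFamily_linesThrough hn hP, h⟩
  · exact ⟨_, isMeetingFamily_linesIn hn hQ, h⟩

end Pencils

/-! ### Induced forests against a meeting family. -/

section Forests

variable {K : Type*} [Field K] [Finite K] {n : ℕ}

open Classical in
theorem IsMeetingFamily.card_filter_not_adj_le {I : Set (QKneserVertex K n 2)}
    (hI : IsMeetingFamily I) {A : Finset (QKneserVertex K n 2)} (hA : ∀ a ∈ A, a ∈ I)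
    {b : QKneserVertex K n 2} (hb : b ∉ I) :
    (A.filter fun a => ¬ (qKneserGraph K n 2).Adj b a).card ≤ Nat.card K + 1 := by
  refine le_trans ?_ (hI.ncard_meet_le b hb)
  rw [← Set.ncard_coe_finset]
  refine Set.ncard_le_ncard fun a ha => ?_
  simp only [Finset.coe_filter, Set.mem_ofPred_eq, qKneserGraph_adj_iff] at ha
  exact ⟨hA a ha.1, ha.2⟩

theorem IsMeetingFamily.card_le {I : Set (QKneserVertex K n 2)}
    (hI : IsMeetingFamily I) {A : Finset (QKneserVertex K n 2)} (hA : ∀ a ∈ A, a ∈ I) :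
    A.card ≤ gaussianBinomial (Nat.card K) (n - 1) 1 := by
  refine le_trans ?_ hI.ncard_le
  rw [← Set.ncard_coe_finset]
  exact Set.ncard_le_ncard fun a ha => hA a ha

/-- At least half of an induced forest with three vertices or more lies in a single meeting
family. -/
theorem IsInducedForest.exists_partition (hn : 4 ≤ n) {F : Finset (QKneserVertex K n 2)}
    (hF : IsInducedForest (qKneserGraph K n 2) F) (hcard : 3 ≤ F.card) :
    ∃ (I : Set (QKneserVertex K n 2)) (A B : Finset (QKneserVertex K n 2)),
      IsMeetingFamily I ∧ A ⊆ F ∧ B ⊆ F ∧ Disjoint A B ∧ (∀ a ∈ A, a ∈ I) ∧ (∀ b ∈ B, b ∉ I) ∧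
      A.card + B.card = F.card ∧ B.card ≤ A.card ∧ (∀ v ∈ F, v ∉ B → v ∈ A) := by
  classical
  obtain ⟨A₀, hA₀F, hA₀, hc⟩ := hF.exists_indep
  obtain ⟨a₁, h₁, a₂, h₂, hne⟩ := Finset.one_lt_card.1 (show 1 < A₀.card by omega)
  obtain ⟨I, hI, hA₀I⟩ := exists_isMeetingFamily hn hA₀ h₁ h₂ hne
  have hsum := Finset.card_filter_add_card_filter_not (s := F) (fun v => v ∈ I)
  have hle : A₀.card ≤ (F.filter fun v => v ∈ I).card :=
    Finset.card_le_card fun a ha => Finset.mem_filter.2 ⟨hA₀F ha, hA₀I ha⟩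
  refine ⟨I, F.filter (· ∈ I), F.filter (· ∉ I), hI, Finset.filter_subset _ _,
    Finset.filter_subset _ _, Finset.disjoint_filter_filter_not _ _ _,
    fun a ha => (Finset.mem_filter.1 ha).2, fun b hb => (Finset.mem_filter.1 hb).2, hsum,
    by omega, ?_⟩
  intro v hv hvB
  simp only [Finset.mem_filter, not_and, not_not] at hvB ⊢
  exact ⟨hv, hvB hv⟩

open Classical in
/-- Each vertex outside a meeting family is adjacent to all but `q + 1` of its members. -/
theorem IsMeetingFamily.card_le_card_filter_adj_add {I : Set (QKneserVertex K n 2)}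
    (hI : IsMeetingFamily I) {A : Finset (QKneserVertex K n 2)} (hA : ∀ a ∈ A, a ∈ I)
    {b : QKneserVertex K n 2} (hb : b ∉ I) :
    A.card ≤ (A.filter ((qKneserGraph K n 2).Adj b)).card + (Nat.card K + 1) := by
  rw [← Finset.card_filter_add_card_filter_not ((qKneserGraph K n 2).Adj b)]
  exact Nat.add_le_add_left (hI.card_filter_not_adj_le hA hb) _

/-- The main inequality: the lower bound on degrees into `A` against the edge bound for forests.
Truncated subtraction is harmless, as it only makes the degree bound zero. -/
theorem IsMeetingFamily.card_mul_lt {F : Finset (QKneserVertex K n 2)}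
    (hF : IsInducedForest (qKneserGraph K n 2) F) {I : Set (QKneserVertex K n 2)}
    (hI : IsMeetingFamily I) {A B : Finset (QKneserVertex K n 2)} (hAF : A ⊆ F) (hBF : B ⊆ F)
    (hd : Disjoint A B) (hA : ∀ a ∈ A, a ∈ I) (hB : ∀ b ∈ B, b ∉ I) (hne : B.Nonempty) :
    B.card * (A.card - (Nat.card K + 1)) + 1 ≤ A.card + B.card := by
  classical
  refine le_trans (Nat.add_le_add_right ?_ 1) (hF.sum_card_adj_lt hAF hBF hd hne)
  rw [← smul_eq_mul]
  refine Finset.card_nsmul_le_sum _ _ _ fun b hb => ?_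
  have := hI.card_le_card_filter_adj_add hA (hB b hb)
  omega

/-- Every induced forest of `K_2(4, 2)` has at most eight vertices. -/
theorem IsInducedForest.card_le_eight {F : Finset (QKneserVertex K 4 2)} (hq : Nat.card K = 2)
    (hF : IsInducedForest (qKneserGraph K 4 2) F) : F.card ≤ 8 := by
  classical
  by_contra! hcon
  obtain ⟨F', hF'F, hcard⟩ := Finset.exists_subset_card_eq (show 9 ≤ F.card by omega)
  replace hF := hF.mono hF'F
  obtain ⟨I, A, B, hI, hAF, hBF, hd, hA, hB, hsum, hle, -⟩ :=
    hF.exists_partition le_rfl (by omega)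
  have hAle := hI.card_le hA
  have hIle := hI.ncard_le
  rw [hq, show gaussianBinomial 2 (4 - 1) 1 = 7 by simp [gaussianBinomial]] at hAle hIle
  have hnot : ∀ b ∈ B, ∀ C ⊆ A, (C.filter fun a => ¬ (qKneserGraph K 4 2).Adj b a).card ≤ 3 :=
    fun b hb C hC => by
      have := hI.card_filter_not_adj_le (fun a ha => hA a (hC ha)) (hB b hb)
      rwa [hq] at this
  have hmul := hI.card_mul_lt hF hAF hBF hd hA hB (Finset.card_pos.1 (by omega))
  have hcom : ∀ b ∈ B, ∀ b' ∈ B, b ≠ b' → (A.filter fun a => (qKneserGraph K 4 2).Adj b a ∧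
      (qKneserGraph K 4 2).Adj b' a).card ≤ 1 := fun b hb b' hb' hne =>
    hF.card_common_le_one hAF (hBF hb) (hBF hb') (Finset.disjoint_right.1 hd hb)
      (Finset.disjoint_right.1 hd hb') hne
  -- From |A| ≤ 7 and 2|A| ≥ 9; the split 6 + 3 fails since 3 · (6 - 3) + 1 > 9.
  have hcases : A.card = 7 ∧ B.card = 2 ∨ A.card = 5 ∧ B.card = 4 := by
    have h1 : A.card = 7 ∨ A.card = 6 ∨ A.card = 5 := by omega
    rw [hcard] at hsum
    rw [hsum, hq] at hmul
    rcases h1 with h | h | h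
    · exact Or.inl ⟨h, by omega⟩
    · rw [h, show B.card = 3 by omega] at hmul
      omega
    · exact Or.inr ⟨h, by omega⟩
  have hunion : ∀ b b' : QKneserVertex K 4 2,
      (A.filter fun a => (qKneserGraph K 4 2).Adj b a ∧ (qKneserGraph K 4 2).Adj b' a).card +
      ((A.filter fun a => ¬ (qKneserGraph K 4 2).Adj b a) ∪
        (A.filter fun a => ¬ (qKneserGraph K 4 2).Adj b' a)).card = A.card := by
    intro b b'
    rw [← Finset.filter_or, ← Finset.card_filter_add_card_filter_not (s := A)
      fun a => (qKneserGraph K 4 2).Adj b a ∧ (qKneserGraph K 4 2).Adj b' a]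
    congr 3
    ext a
    tauto
  have hui : ∀ b b' : QKneserVertex K 4 2, _ := fun b b' => Finset.card_union_add_card_inter
    (A.filter fun a => ¬ (qKneserGraph K 4 2).Adj b a)
    (A.filter fun a => ¬ (qKneserGraph K 4 2).Adj b' a)
  rcases hcases with ⟨hA7, hB2⟩ | ⟨hA5, hB4⟩
  · obtain ⟨b, hb, b', hb', hne⟩ := Finset.one_lt_card.1 (show 1 < B.card by omega)
    -- Here `A` is all of `I`, so it contains `c`. The two sets of non-neighbours, of size at most
    -- 3, share `c` and cover at most 5 of the 7 lines, leaving two common neighbours.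
    obtain ⟨c, hcI, hc, hc'⟩ := hI.exists_meet rfl b (hB b hb) b' (hB b' hb')
    have hAI : (A : Set (QKneserVertex K 4 2)) = I :=
      Set.eq_of_subset_of_ncard_le (fun a ha => hA a ha)
        (by rw [Set.ncard_coe_finset]; omega)
    have hcA : c ∈ A := by rwa [← hAI] at hcI
    have hpos : 0 < ((A.filter fun a => ¬ (qKneserGraph K 4 2).Adj b a) ∩
        (A.filter fun a => ¬ (qKneserGraph K 4 2).Adj b' a)).card :=
      Finset.card_pos.2 ⟨c, by simp [hcA, qKneserGraph_adj_iff, hc, hc']⟩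
    have h1 := hnot b hb A subset_rfl
    have h2 := hnot b' hb' A subset_rfl
    have h3 := hcom b hb b' hb' hne
    have h4 := hunion b b'
    have h5 := hui b b'
    omega
  · have hsumle := hF.sum_card_adj_lt hAF hBF hd (Finset.card_pos.1 (by omega))
    have hcompl : ∀ b, (A.filter ((qKneserGraph K 4 2).Adj b)).card +
        (A.filter fun a => ¬ (qKneserGraph K 4 2).Adj b a).card = 5 := fun b => by
      rw [← hA5]
      exact Finset.card_filter_add_card_filter_not _
    have hge : ∀ b ∈ B, 2 ≤ (A.filter ((qKneserGraph K 4 2).Adj b)).card := by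
      intro b hb
      have h1 := hnot b hb A subset_rfl
      have h2 := hcompl b
      omega
    have heq : ∀ b ∈ B, (A.filter ((qKneserGraph K 4 2).Adj b)).card = 2 := by
      have h1 : ∑ b ∈ B, 2 = ∑ b ∈ B, (A.filter ((qKneserGraph K 4 2).Adj b)).card := by
        refine le_antisymm (Finset.sum_le_sum hge) ?_
        rw [Finset.sum_const, smul_eq_mul]
        omega
      exact fun b hb => ((Finset.sum_eq_sum_iff_of_le hge).1 h1 b hb).symm
    -- A common neighbour would leave two lines of `A` met by both `b` and `b'`. Then their
    -- non-neighbours in `A` coincide, giving two common neighbours. Disjointness in turn needs 4 ·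
    -- 2 ≤ 5.
    have hdisj : ∀ b ∈ B, ∀ b' ∈ B, b ≠ b' → Disjoint (A.filter ((qKneserGraph K 4 2).Adj b))
        (A.filter ((qKneserGraph K 4 2).Adj b')) := by
      intro b hb b' hb' hne
      rw [Finset.disjoint_iff_inter_eq_empty, ← Finset.filter_and, ← Finset.card_eq_zero]
      by_contra hne0
      have h1 := hcompl b
      have h2 := hcompl b'
      rw [heq b hb] at h1
      rw [heq b' hb'] at h2
      have h3 := hcom b hb b' hb' hne
      have h4 := hunion b b'
      have h5 := hui b b'
      obtain ⟨a₁, ha₁, a₂, ha₂, hne'⟩ := Finset.one_lt_card.1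
        (show 1 < ((A.filter fun a => ¬ (qKneserGraph K 4 2).Adj b a) ∩
          (A.filter fun a => ¬ (qKneserGraph K 4 2).Adj b' a)).card by omega)
      simp only [Finset.mem_inter, Finset.mem_filter, qKneserGraph_adj_iff] at ha₁ ha₂
      have hsub : (A.filter fun a => ¬ (qKneserGraph K 4 2).Adj b a) ⊆
          (A.filter fun a => ¬ (qKneserGraph K 4 2).Adj b' a) := by
        intro c hc
        simp only [Finset.mem_filter, qKneserGraph_adj_iff] at hc ⊢
        exact ⟨hc.1, hI.meet_of_meet b (hB b hb) b' (hB b' hb') a₁ (hA _ ha₁.1.1) a₂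
          (hA _ ha₂.1.1) hne' ha₁.1.2 ha₂.1.2 ha₁.2.2 ha₂.2.2 c (hA _ hc.1) hc.2⟩
      rw [Finset.union_eq_right.2 hsub] at h4
      omega
    have h1 := Finset.card_biUnion (s := B)
      (t := fun b => A.filter ((qKneserGraph K 4 2).Adj b)) hdisj
    have h2 : (B.biUnion fun b => A.filter ((qKneserGraph K 4 2).Adj b)).card ≤ A.card :=
      Finset.card_le_card (Finset.biUnion_subset.2 fun b _ => Finset.filter_subset _ _)
    rw [Finset.sum_congr rfl heq, Finset.sum_const, smul_eq_mul] at h1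
    omega

/-- With b = x + 2 and a = y + q + 3 the inequality becomes xy + x + y ≤ q, too small for the given
a + b. The thresholds are θ + 1 at n = 5 for q = 2 (that is, 16), and at n = 4 for q ≥ 3. -/
theorem mul_sub_not_le {a b q : ℕ} (hb : 2 ≤ b) (hba : b ≤ a)
    (hq : q = 2 ∧ 16 ≤ a + b ∨ 3 ≤ q ∧ q * q + q + 2 ≤ a + b) :
    ¬ b * (a - (q + 1)) + 1 ≤ a + b := by
  intro h
  have ha : q + 3 ≤ a := by rcases hq with hq | hq <;> nlinarith
  obtain ⟨x, rfl⟩ := Nat.exists_eq_add_of_le' hb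
  obtain ⟨y, rfl⟩ := Nat.exists_eq_add_of_le' ha
  rw [show y + (q + 3) - (q + 1) = y + 2 by omega] at h
  rcases hq with hq | hq
  · obtain ⟨rfl, hq⟩ := hq
    nlinarith [Nat.zero_le (x * y)]
  · nlinarith [Nat.zero_le (x * y)]

theorem IsInducedForest.canonical_of_lt_card (hn : 4 ≤ n) (hnq : (n, Nat.card K) ≠ (4, 2))
    {F : Finset (QKneserVertex K n 2)} (hF : IsInducedForest (qKneserGraph K n 2) F)
    (hcard : gaussianBinomial (Nat.card K) (n - 1) 1 < F.card) :
    F.card = gaussianBinomial (Nat.card K) (n - 1) 1 + 1 ∧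
      IsCanonicalForest (qKneserGraph K n 2) F := by
  have hq := Finite.one_lt_card (α := K)
  have hmono := gaussianBinomial_one_mono hq.le
  have h3 : gaussianBinomial (Nat.card K) 3 1 = 1 + Nat.card K * (1 + Nat.card K) := by
    simp [gaussianBinomial]
  have hθ : gaussianBinomial (Nat.card K) 3 1 ≤ gaussianBinomial (Nat.card K) (n - 1) 1 :=
    hmono (by omega)
  obtain ⟨I, A, B, hI, hAF, hBF, hd, hA, hB, hsum, hle, hcov⟩ :=
    hF.exists_partition hn (by nlinarith)
  have hAle := hI.card_le hA
  obtain ⟨v, hv⟩ : B.Nonempty := Finset.card_pos.1 (by omega)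
  have hmul := hI.card_mul_lt hF hAF hBF hd hA hB ⟨v, hv⟩
  have hB1 : B.card = 1 := by
    by_contra hB1
    have hB2 : 2 ≤ B.card := by
      have := Finset.card_pos.2 ⟨v, hv⟩
      omega
    refine mul_sub_not_le hB2 hle (q := Nat.card K) ?_ hmul
    rcases (show Nat.card K = 2 ∨ 3 ≤ Nat.card K by omega) with h2 | h2
    · have h5 : gaussianBinomial (Nat.card K) 4 1 ≤ gaussianBinomial (Nat.card K) (n - 1) 1 := by
        refine hmono ?_
        have : n ≠ 4 := fun h => hnq (by rw [h, h2])
        omega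
      rw [h2, show gaussianBinomial 2 4 1 = 15 by simp [gaussianBinomial], ← h2] at h5
      exact Or.inl ⟨h2, by omega⟩
    · exact Or.inr ⟨h2, by nlinarith⟩
  refine ⟨by omega, hF, v, hBF hv, ?_⟩
  obtain ⟨w, hw⟩ := Finset.card_eq_one.1 hB1
  refine hI.isIndepSet.mono fun u hu => hA u (hcov u hu.1 ?_)
  rw [hw, Finset.mem_singleton] at hv ⊢
  exact hv ▸ hu.2

theorem exists_isInducedForest_card (hn : 4 ≤ n) :
    ∃ F : Finset (QKneserVertex K n 2), IsInducedForest (qKneserGraph K n 2) F ∧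
      F.card = gaussianBinomial (Nat.card K) (n - 1) 1 + 1 := by
  classical
  have : Fintype (QKneserVertex K n 2) := Fintype.ofFinite _
  have hP : Module.finrank K ↥(K ∙ (Pi.single ⟨0, by omega⟩ 1 : Fin n → K)) = 1 :=
    finrank_span_singleton (by simp)
  set P := K ∙ (Pi.single ⟨0, by omega⟩ 1 : Fin n → K)
  have hI := isMeetingFamily_linesThrough hn hP
  have hcard := ncard_lines_through hP (by omega)
  rw [Set.ncard_eq_toFinset_card'] at hcard
  obtain ⟨U, hU⟩ : ∃ U : QKneserVertex K n 2, ¬ P ≤ U.1 := by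
    -- A line avoiding `P` is found inside a complement of `P`.
    obtain ⟨C, hC⟩ := P.exists_isCompl
    have hdim := Submodule.finrank_add_eq_of_isCompl hC
    rw [hP, Module.finrank_fin_fun] at hdim
    have hCbot : C ≠ ⊥ := by
      rintro rfl
      rw [finrank_bot] at hdim
      omega
    obtain ⟨v, hvC, hv⟩ := Submodule.exists_mem_ne_zero_of_ne_bot hCbot
    obtain ⟨U, -, hUC⟩ := exists_line_between (finrank_span_singleton (K := K) hv)
      (by simpa using hvC) (show 2 ≤ Module.finrank K C by omega)
    refine ⟨U, fun hPU => ?_⟩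
    have hbot := le_bot_iff.1 (hC.disjoint le_rfl (hPU.trans hUC))
    rw [hbot, finrank_bot] at hP
    omega
  refine ⟨insert U {c : QKneserVertex K n 2 | P ≤ c.1}.toFinset,
    isInducedForest_insert (by simpa using hI.isIndepSet) _, ?_⟩
  rw [Finset.card_insert_of_notMem (by simpa using hU), hcard]

end Forests

/-! ### The main theorem. -/

theorem mainTheorem9 (q n : ℕ) (hn : 4 ≤ n)
    (K : Type*) [Field K] [Finite K] (hq : Nat.card K = q) :
    acyclicNumber (qKneserGraph K n 2) = max (gaussianBinomial q (n - 1) 1 + 1) 8 ∧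
      ((n, q) ≠ (4, 2) →
        ∀ F : Finset (QKneserVertex K n 2),
          IsMaximumInducedForest (qKneserGraph K n 2) F →
            IsCanonicalForest (qKneserGraph K n 2) F) := by
  subst hq
  obtain ⟨F₀, hF₀, hF₀card⟩ := exists_isInducedForest_card (K := K) hn
  have h3 : gaussianBinomial (Nat.card K) 3 1 = 1 + Nat.card K * (1 + Nat.card K) := by
    simp [gaussianBinomial]
  have hq := Finite.one_lt_card (α := K)
  have hmono : gaussianBinomial (Nat.card K) 3 1 ≤ gaussianBinomial (Nat.card K) (n - 1) 1 :=
    gaussianBinomial_one_mono hq.le (by omega)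
  constructor
  · rw [max_eq_left (by nlinarith)]
    refine IsGreatest.csSup_eq ⟨⟨F₀, hF₀, hF₀card⟩, ?_⟩
    rintro _ ⟨F, hF, rfl⟩
    by_cases hnq : (n, Nat.card K) = (4, 2)
    · obtain ⟨rfl, h2⟩ := Prod.mk.inj hnq
      refine (hF.card_le_eight h2).trans ?_
      nlinarith
    · by_contra! hlt
      exact hlt.ne' (hF.canonical_of_lt_card hn hnq (by omega)).1
  · intro hnq F hF
    have := hF.2 F₀ hF₀
    exact (hF.1.canonical_of_lt_card hn hnq (by omega)).2
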